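/- For real numbers $\epsilon,\epsilon'$, $\zeta\in\mathbb{C}$ and $\tau$ in the upper half plane, let $$\theta\begin{bmatrix}\epsilon\\ \epsilon'\end{bmatrix}(\zeta,\tau)=\sum_{n\in\mathbb{Z}}\exp\left(2\pi i\left[\tfrac12\left(n+\tfrac{\epsilon}{2}\right)^2\tau+\left(n+\tfrac{\epsilon}{2}\right)\left(\zeta+\tfrac{\epsilon'}{2}\right)\right]\right),\qquad \theta'\begin{bmatrix}\epsilon\\ \epsilon'\end{bmatrix}(0,\tau)=\left.\frac{\partial}{\partial\zeta}\theta\begin{bmatrix}\epsilon\\ \epsilon'\end{bmatrix}(\zeta,\tau)\right|_{\zeta=0}.$$ Theorem. For every $\tau$ in the upper half plane, $$D(\tau):=\theta^4\begin{bmatrix}1\\ \frac14\end{bmatrix}(0,\tau)-\theta^4\begin{bmatrix}1\\ \frac34\end{bmatrix}(0,\tau)\neq 0,$$ and, with $$K(\tau):=\theta\begin{bmatrix}1\\0\end{bmatrix}(0,4\tau)\,\theta\begin{bmatrix}0\\1\end{bmatrix}(0,4\tau)\left\{\theta^2\begin{bmatrix}0\\0\end{bmatrix}(0,4\tau)+3\,\theta^2\begin{bmatrix}1\\0\end{bmatrix}(0,4\tau)\right\},$$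 one has $$\theta'\begin{bmatrix}1\\ \frac14\end{bmatrix}(0,\tau)=\frac{-2\pi\,\theta\begin{bmatrix}1\\ \frac14\end{bmatrix}(0,\tau)\,\theta^2\begin{bmatrix}0\\0\end{bmatrix}(0,4\tau)}{D(\tau)}\left(K(\tau)+\theta^4\begin{bmatrix}1\\ \frac34\end{bmatrix}(0,\tau)\right)$$ and $$\theta'\begin{bmatrix}1\\ \frac34\end{bmatrix}(0,\tau)=\frac{-2\pi\,\theta\begin{bmatrix}1\\ \frac34\end{bmatrix}(0,\tau)\,\theta^2\begin{bmatrix}0\\0\end{bmatrix}(0,4\tau)}{D(\tau)}\left(K(\tau)+\theta^4\begin{bmatrix}1\\ \frac14\end{bmatrix}(0,\tau)\right).$$ -/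

import Mathlib

/-- The theta function with real characteristics `[ε; ε']`, for `ζ : ℂ` and `0 < im τ`. -/
noncomputable def thetaChar (ε ε' : ℝ) (ζ τ : ℂ) : ℂ :=
  ∑' n : ℤ, Complex.exp (2 * Real.pi * Complex.I *
    (1 / 2 * ((n : ℂ) + ε / 2) ^ 2 * τ + ((n : ℂ) + ε / 2) * (ζ + ε' / 2)))

/-- The derivative constant: the derivative of `ζ ↦ thetaChar ε ε' ζ τ` at `ζ = 0`. -/
noncomputable def thetaCharDeriv (ε ε' : ℝ) (τ : ℂ) : ℂ :=
  deriv (fun ζ : ℂ => thetaChar ε ε' ζ τ) 0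

lemma thetaChar_term_eq (ε ε' : ℝ) (ζ τ : ℂ) (n : ℤ) :
    Complex.exp (2 * Real.pi * Complex.I *
      (1 / 2 * ((n : ℂ) + ε / 2) ^ 2 * τ + ((n : ℂ) + ε / 2) * (ζ + ε' / 2))) =
    Complex.exp (Real.pi * Complex.I * (ε ^ 2 / 4 * τ + ε * (ζ + ε' / 2))) *
      jacobiTheta₂_term n (ζ + ε' / 2 + ε / 2 * τ) τ := by
  rw [jacobiTheta₂_term, ← Complex.exp_add]
  congr 1
  ring

/-- The defining series converges on the upper half plane. -/
lemma thetaChar_hasSum (ε ε' : ℝ) (ζ : ℂ) {τ : ℂ} (hτ : 0 < τ.im) :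
    HasSum (fun n : ℤ => Complex.exp (2 * Real.pi * Complex.I *
      (1 / 2 * ((n : ℂ) + ε / 2) ^ 2 * τ + ((n : ℂ) + ε / 2) * (ζ + ε' / 2))))
      (thetaChar ε ε' ζ τ) := by
  refine Summable.hasSum ?_
  simp only [thetaChar_term_eq]
  exact ((hasSum_jacobiTheta₂_term _ hτ).summable).mul_left _

lemma thetaChar_eq (ε ε' : ℝ) (ζ τ : ℂ) :
    thetaChar ε ε' ζ τ =
      Complex.exp (Real.pi * Complex.I * (ε ^ 2 / 4 * τ + ε * (ζ + ε' / 2))) *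
        jacobiTheta₂ (ζ + ε' / 2 + ε / 2 * τ) τ := by
  simp only [thetaChar, thetaChar_term_eq, tsum_mul_left, jacobiTheta₂]

/-- The theta function is entire in `ζ`, so `thetaCharDeriv` is a genuine derivative. -/
lemma thetaChar_hasDerivAt (ε ε' : ℝ) {τ : ℂ} (hτ : 0 < τ.im) :
    HasDerivAt (fun ζ : ℂ => thetaChar ε ε' ζ τ) (thetaCharDeriv ε ε' τ) 0 := by
  refine DifferentiableAt.hasDerivAt ?_
  simp only [thetaChar_eq]
  refine DifferentiableAt.mul (by fun_prop) ?_
  exact DifferentiableAt.comp (g := fun z => jacobiTheta₂ z τ) (0 : ℂ)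
    (differentiableAt_jacobiTheta₂_fst _ hτ) (by fun_prop)

/-! Since $\theta[1;\epsilon'](0,\tau)=\theta[1;0](\epsilon'/2,\tau)$, the claim concerns
$\theta[1;0]$ and its derivative at $1/8$ and $3/8$. Everything rests on the addition formula
`thetaChar_mul_thetaChar`, which passes from $\tau$ to $2\tau$. Applied to values, it gives
$x^2=bu+av$, $y^2=bu-av$ and $xy=wa$ for the values $x,y$ at $1/8,3/8$, so $D=4abuv$, a product of
nonvanishing constants. Differentiated (`deriv_thetaChar_one_mul_sub`), it gives two linear
equations for $x'y$ and $xy'$, whose right sides are known from the derivatives at $1/2$ (Jacobi's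
formula) and $1/4$. A polynomial identity in constants at $4\tau$ finishes the proof. Nonvanishing
and Jacobi's formula both come from iterating $\tau\mapsto2\tau$ and comparing with the limit at
$i\infty$. -/

open Filter Topology

/-! ### Addition formula -/

/-- Reparametrisation of pairs of integers by half-sum and half-difference, according to the parity
of the sum. -/
def intProdParityEquiv : (ℤ × ℤ) ⊕ (ℤ × ℤ) ≃ ℤ × ℤ where
  toFun := Sum.elim (fun p => (p.1 + p.2, p.1 - p.2)) (fun p => (p.1 + p.2 + 1, p.1 - p.2))
  invFun p := if (p.1 + p.2) % 2 = 0 then Sum.inl ((p.1 + p.2) / 2, (p.1 - p.2) / 2)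
    else Sum.inr ((p.1 + p.2) / 2, (p.1 - p.2) / 2)
  left_inv := by
    rintro (⟨p, q⟩ | ⟨p, q⟩)
    · have h1 : (p + q + (p - q)) % 2 = 0 := by omega
      simp only [Sum.elim_inl, h1, if_true, Sum.inl.injEq, Prod.mk.injEq]
      constructor <;> omega
    · have h1 : ¬ (p + q + 1 + (p - q)) % 2 = 0 := by omega
      simp only [Sum.elim_inr, h1, if_false, Sum.inr.injEq, Prod.mk.injEq]
      constructor <;> omega
  right_inv := by
    rintro ⟨m, n⟩
    by_cases h : (m + n) % 2 = 0
    · simp only [h, if_true, Sum.elim_inl, Prod.mk.injEq]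
      constructor <;> omega
    · simp only [h, if_false, Sum.elim_inr, Prod.mk.injEq]
      constructor <;> omega

theorem hasSum_thetaChar_mul_thetaChar (c c' d d' : ℝ) (u v : ℂ) {σ : ℂ} (hσ : 0 < σ.im) :
    HasSum (fun p : ℤ × ℤ => Complex.exp (2 * Real.pi * Complex.I *
      ((1 / 2 * ((p.1 : ℂ) + c / 2) ^ 2 * σ + ((p.1 : ℂ) + c / 2) * (u + c' / 2)) +
        (1 / 2 * ((p.2 : ℂ) + d / 2) ^ 2 * σ + ((p.2 : ℂ) + d / 2) * (v + d' / 2)))))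
      (thetaChar c c' u σ * thetaChar d d' v σ) := by
  have key : ∀ {f g : ℤ → ℂ} {s t : ℂ}, HasSum f s → HasSum g t →
      HasSum (fun p : ℤ × ℤ => f p.1 * g p.2) (s * t) := fun hf hg =>
    hf.mul hg (summable_mul_of_summable_norm hf.summable.norm hg.summable.norm)
  refine (key (thetaChar_hasSum c c' u hσ) (thetaChar_hasSum d d' v hσ)).congr_fun fun p => ?_
  rw [mul_add, Complex.exp_add]

/-- The addition formula expressing a product of theta functions at `τ` through theta functions
at `2 * τ`. -/
theorem thetaChar_mul_thetaChar (a a' b b' : ℝ) (x y : ℂ) {τ : ℂ} (hτ : 0 < τ.im) :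
    thetaChar a a' x τ * thetaChar b b' y τ =
      thetaChar ((a + b) / 2) (a' + b') (x + y) (2 * τ) *
          thetaChar ((a - b) / 2) (a' - b') (x - y) (2 * τ) +
        thetaChar ((a + b) / 2 + 1) (a' + b') (x + y) (2 * τ) *
          thetaChar ((a - b) / 2 + 1) (a' - b') (x - y) (2 * τ) := by
  have h2 : 0 < (2 * τ).im := by simpa using hτ
  have hL := hasSum_thetaChar_mul_thetaChar a a' b b' x y hτ
  rw [← intProdParityEquiv.hasSum_iff] at hL
  refine hL.unique (HasSum.sum ?_ ?_)
  · convert hasSum_thetaChar_mul_thetaChar ((a + b) / 2) (a' + b') ((a - b) / 2) (a' - b')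
      (x + y) (x - y) h2 using 1
    funext p
    simp only [Function.comp_apply, intProdParityEquiv, Equiv.coe_fn_mk, Sum.elim_inl]
    congr 1
    push_cast
    ring
  -- For an odd sum, half-sum and half-difference are $p+\frac12$ and $q+\frac12$, which raises both
  -- upper characteristics by 1.
  · convert hasSum_thetaChar_mul_thetaChar ((a + b) / 2 + 1) (a' + b') ((a - b) / 2 + 1) (a' - b')
      (x + y) (x - y) h2 using 1
    funext p
    simp only [Function.comp_apply, intProdParityEquiv, Equiv.coe_fn_mk, Sum.elim_inr]
    congr 1
    push_cast
    ring

/-! ### Periodicity, parity and special cases of the addition formula -/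

theorem thetaChar_add_two (ε ε' : ℝ) (ζ τ : ℂ) :
    thetaChar (ε + 2) ε' ζ τ = thetaChar ε ε' ζ τ := by
  refine Eq.trans (tsum_congr fun n => ?_) ((Equiv.addRight (1 : ℤ)).tsum_eq _)
  congr 1
  simp only [Equiv.coe_addRight]
  push_cast
  ring

theorem thetaChar_neg (ε ε' : ℝ) (ζ τ : ℂ) :
    thetaChar (-ε) (-ε') (-ζ) τ = thetaChar ε ε' ζ τ := by
  rw [thetaChar, thetaChar, ← (Equiv.neg ℤ).tsum_eq]
  refine tsum_congr fun n => ?_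
  congr 1
  simp only [Equiv.neg_apply]
  push_cast
  ring

theorem thetaChar_add_one_right (ε ε' : ℝ) (ζ τ : ℂ) :
    thetaChar ε ε' (ζ + 1) τ = Complex.exp (Real.pi * Complex.I * ε) * thetaChar ε ε' ζ τ := by
  rw [thetaChar, thetaChar, ← tsum_mul_left]
  refine tsum_congr fun n => ?_
  rw [← Complex.exp_add, Complex.exp_eq_exp_iff_exists_int]
  exact ⟨n, by ring⟩

theorem thetaChar_eq_shift (ε ε' : ℝ) (ζ τ : ℂ) :
    thetaChar ε ε' ζ τ = thetaChar ε 0 (ζ + ε' / 2) τ := by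
  simp [thetaChar]

theorem differentiableAt_thetaChar (ε ε' : ℝ) (ζ : ℂ) {τ : ℂ} (hτ : 0 < τ.im) :
    DifferentiableAt ℂ (fun z => thetaChar ε ε' z τ) ζ := by
  simp only [thetaChar_eq]
  refine DifferentiableAt.mul (by fun_prop) ?_
  exact DifferentiableAt.comp (g := fun z => jacobiTheta₂ z τ) ζ
    (differentiableAt_jacobiTheta₂_fst _ hτ) (by fun_prop)

theorem thetaChar_one_neg (ζ τ : ℂ) : thetaChar 1 0 (-ζ) τ = thetaChar 1 0 ζ τ := by
  have h1 := thetaChar_neg 1 0 ζ τ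
  have h2 := thetaChar_add_two (-1) 0 (-ζ) τ
  norm_num at h1 h2
  rw [h2, h1]

theorem thetaChar_zero_neg (ζ τ : ℂ) : thetaChar 0 0 (-ζ) τ = thetaChar 0 0 ζ τ := by
  simpa using thetaChar_neg 0 0 ζ τ

theorem thetaChar_one_add_one (ζ τ : ℂ) : thetaChar 1 0 (ζ + 1) τ = -thetaChar 1 0 ζ τ := by
  simp [thetaChar_add_one_right]

theorem thetaChar_zero_add_one (ζ τ : ℂ) : thetaChar 0 0 (ζ + 1) τ = thetaChar 0 0 ζ τ := by
  simp [thetaChar_add_one_right]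

theorem thetaChar_one_half (τ : ℂ) : thetaChar 1 0 (1 / 2) τ = 0 := by
  have h := thetaChar_one_add_one (-(1 / 2)) τ
  rw [thetaChar_one_neg, show -(1 / 2 : ℂ) + 1 = 1 / 2 by norm_num] at h
  exact self_eq_neg.mp h

theorem thetaChar_one_mul_one (x y : ℂ) {τ : ℂ} (hτ : 0 < τ.im) :
    thetaChar 1 0 x τ * thetaChar 1 0 y τ =
      thetaChar 1 0 (x + y) (2 * τ) * thetaChar 0 0 (x - y) (2 * τ) +
        thetaChar 0 0 (x + y) (2 * τ) * thetaChar 1 0 (x - y) (2 * τ) := by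
  have h := thetaChar_mul_thetaChar 1 0 1 0 x y hτ
  have h2 := thetaChar_add_two 0 0 (x + y) (2 * τ)
  norm_num at h h2
  rw [h, h2]

theorem thetaChar_zero_mul_zero (x y : ℂ) {τ : ℂ} (hτ : 0 < τ.im) :
    thetaChar 0 0 x τ * thetaChar 0 0 y τ =
      thetaChar 0 0 (x + y) (2 * τ) * thetaChar 0 0 (x - y) (2 * τ) +
        thetaChar 1 0 (x + y) (2 * τ) * thetaChar 1 0 (x - y) (2 * τ) := by
  simpa using thetaChar_mul_thetaChar 0 0 0 0 x y hτ

/-! ### Limits at $i\infty$ -/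

theorem tendsto_two_pow_mul {τ : ℂ} (hτ : 0 < τ.im) :
    Tendsto (fun k : ℕ => (2 : ℂ) ^ k * τ) atTop (comap Complex.im atTop) := by
  rw [tendsto_comap_iff]
  have h : (Complex.im ∘ fun k : ℕ => (2 : ℂ) ^ k * τ) = fun k : ℕ => (2 : ℝ) ^ k * τ.im := by
    funext k
    have : ((2 : ℂ) ^ k) = (((2 : ℝ) ^ k : ℝ) : ℂ) := by push_cast; rfl
    simp only [Function.comp_apply]
    rw [this, Complex.im_ofReal_mul]
  rw [h]
  exact (tendsto_pow_atTop_atTop_of_one_lt one_lt_two).atTop_mul_const hτ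

/-- Termwise limit at `i∞` of a series with quadratically growing exponents. -/
theorem tendsto_tsum_mul_exp {c : ℤ → ℂ} {e : ℤ → ℤ} {C : ℝ}
    (hc : ∀ n, ‖c n‖ ≤ C * (|(n : ℝ)| + 1)) (he0 : ∀ n, 0 ≤ e n)
    (he : ∀ n, n ^ 2 - |n| ≤ e n) :
    Tendsto (fun τ : ℂ => ∑' n : ℤ, c n * Complex.exp (Real.pi * Complex.I * e n * τ))
      (comap Complex.im atTop) (𝓝 (∑' n : ℤ, if e n = 0 then c n else 0)) := by
  have hnorm : ∀ (n : ℤ) (τ : ℂ), ‖Complex.exp (Real.pi * Complex.I * e n * τ)‖ =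
      Real.exp (-(Real.pi * e n * τ.im)) := by
    intro n τ
    rw [Complex.norm_exp]
    congr 1
    have : (Real.pi * Complex.I * e n * τ : ℂ) = ((Real.pi * e n : ℝ) : ℂ) * (Complex.I * τ) := by
      push_cast; ring
    rw [this, Complex.re_ofReal_mul]
    simp
  have hC : 0 ≤ C := by simpa using (norm_nonneg _).trans (hc 0)
  -- Majorant valid for $\operatorname{im}\tau\ge1$, from $e_n\ge n^2-|n|$.
  have hs : Summable fun n : ℤ => C * ((|(n : ℝ)| + 1) *
      Real.exp (-Real.pi * (1 * (n : ℝ) ^ 2 - 2 * (1 / 2) * |(n : ℝ)|))) := by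
    have h1 := summable_pow_mul_jacobiTheta₂_term_bound (1 / 2) one_pos 1
    have h0 := summable_pow_mul_jacobiTheta₂_term_bound (1 / 2) one_pos 0
    refine ((h1.add h0).congr fun n => ?_).mul_left C
    push_cast
    ring
  refine tendsto_tsum_of_dominated_convergence hs ?_ ?_
  · intro n
    split_ifs with h
    · simpa [h] using tendsto_const_nhds
    · have hpos : (0 : ℝ) < e n := by exact_mod_cast lt_of_le_of_ne (he0 n) (Ne.symm h)
      rw [tendsto_zero_iff_norm_tendsto_zero]
      simp only [norm_mul, hnorm]
      rw [← mul_zero ‖c n‖]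
      refine Tendsto.const_mul _ (Real.tendsto_exp_neg_atTop_nhds_zero.comp ?_)
      exact Tendsto.const_mul_atTop (mul_pos Real.pi_pos hpos) tendsto_comap
  · filter_upwards [tendsto_comap.eventually (eventually_ge_atTop (1 : ℝ))] with τ hτ n
    rw [norm_mul, hnorm, ← mul_assoc]
    refine mul_le_mul (hc n) (Real.exp_le_exp.mpr ?_) (Real.exp_nonneg _) (by positivity)
    have h1 : (n : ℝ) ^ 2 - |(n : ℝ)| ≤ e n := by exact_mod_cast he n
    have h2 : (0 : ℝ) ≤ e n := by exact_mod_cast he0 n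
    have h3 : (n : ℝ) ^ 2 - |(n : ℝ)| ≤ e n * τ.im := h1.trans (le_mul_of_one_le_right h2 hτ)
    have := mul_le_mul_of_nonneg_left h3 Real.pi_pos.le
    linarith

/-- $\theta[1;0]$ tends to 0 at $i\infty$; removing $e^{\pi i\tau/4}$ leaves a series with a nonzero
limit, contributed by $n=0$ and $n=-1$. -/
theorem thetaChar_one_zero_eq_tsum (τ : ℂ) :
    thetaChar 1 0 0 τ = Complex.exp (Real.pi * Complex.I * τ / 4) *
      ∑' n : ℤ, 1 * Complex.exp (Real.pi * Complex.I * (n ^ 2 + n : ℤ) * τ) := by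
  rw [thetaChar, ← tsum_mul_left]
  refine tsum_congr fun n => ?_
  rw [one_mul, ← Complex.exp_add]
  congr 1
  push_cast
  ring

theorem deriv_thetaChar_one_half_eq_tsum {τ : ℂ} (hτ : 0 < τ.im) :
    deriv (fun z => thetaChar 1 0 z τ) (1 / 2) = Complex.exp (Real.pi * Complex.I * τ / 4) *
      ∑' n : ℤ, (2 * Real.pi * Complex.I * (n + 1 / 2) *
        Complex.exp (Real.pi * Complex.I * (n + 1 / 2))) *
          Complex.exp (Real.pi * Complex.I * (n ^ 2 + n : ℤ) * τ) := by
  have hJ : HasDerivAt (fun z : ℂ => jacobiTheta₂ (z + τ / 2) τ)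
      (jacobiTheta₂' (1 / 2 + τ / 2) τ) (1 / 2) :=
    (hasDerivAt_jacobiTheta₂_fst (1 / 2 + τ / 2) hτ).comp_add_const (1 / 2) (τ / 2)
  have hE : HasDerivAt (fun z : ℂ => Complex.exp (Real.pi * Complex.I * (τ / 4 + z)))
      (Complex.exp (Real.pi * Complex.I * (τ / 4 + 1 / 2)) * (Real.pi * Complex.I * 1)) (1 / 2) :=
    (((hasDerivAt_id' (1 / 2 : ℂ)).const_add (τ / 4)).const_mul _).cexp
  have hQ : (fun z => thetaChar 1 0 z τ) = fun z : ℂ =>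
      Complex.exp (Real.pi * Complex.I * (τ / 4 + z)) * jacobiTheta₂ (z + τ / 2) τ := by
    funext z
    rw [thetaChar_eq]
    congr 2 <;> push_cast <;> ring
  rw [hQ]
  refine (hE.mul hJ).deriv.trans ?_
  rw [← tsum_mul_left]
  have hs := ((hasSum_jacobiTheta₂_term (1 / 2 + τ / 2) hτ).mul_left
    (Complex.exp (Real.pi * Complex.I * (τ / 4 + 1 / 2)) * (Real.pi * Complex.I * 1))).add
    ((hasSum_jacobiTheta₂'_term (1 / 2 + τ / 2) hτ).mul_left
      (Complex.exp (Real.pi * Complex.I * (τ / 4 + 1 / 2))))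
  rw [← hs.tsum_eq]
  refine tsum_congr fun n => ?_
  have he : Complex.exp (Real.pi * Complex.I * (τ / 4 + 1 / 2)) *
      jacobiTheta₂_term n (1 / 2 + τ / 2) τ =
      Complex.exp (Real.pi * Complex.I * τ / 4) *
        (Complex.exp (Real.pi * Complex.I * (n + 1 / 2)) *
          Complex.exp (Real.pi * Complex.I * (n ^ 2 + n : ℤ) * τ)) := by
    rw [jacobiTheta₂_term]
    simp only [← Complex.exp_add]
    congr 1
    push_cast
    ring
  rw [jacobiTheta₂'_term]
  linear_combination (2 * Real.pi * Complex.I * (n + 1 / 2)) * he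

theorem sq_add_self_nonneg (n : ℤ) : 0 ≤ n ^ 2 + n := by
  rcases le_or_gt 0 n with h | h <;> nlinarith

theorem sq_sub_abs_le (n : ℤ) : n ^ 2 - |n| ≤ n ^ 2 + n := by
  linarith [neg_abs_le n]

theorem tsum_ite_sq_add_self (c : ℤ → ℂ) :
    (∑' n : ℤ, if n ^ 2 + n = 0 then c n else 0) = c 0 + c (-1) := by
  rw [tsum_eq_sum (s := {0, -1})]
  · simp
  · intro n hn
    rw [if_neg]
    intro h
    have : n * (n + 1) = 0 := by linarith
    simp only [Finset.mem_insert, Finset.mem_singleton] at hn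
    rcases mul_eq_zero.mp this with h | h <;> omega

theorem tendsto_thetaChar_one_series :
    Tendsto (fun τ : ℂ => ∑' n : ℤ, 1 * Complex.exp (Real.pi * Complex.I * (n ^ 2 + n : ℤ) * τ))
      (comap Complex.im atTop) (𝓝 2) := by
  have h := tendsto_tsum_mul_exp (c := fun _ => 1) (e := fun n => n ^ 2 + n) (C := 1)
    (fun n => by simp) sq_add_self_nonneg sq_sub_abs_le
  rw [tsum_ite_sq_add_self, one_add_one_eq_two] at h
  exact h

theorem tendsto_deriv_thetaChar_one_series :
    Tendsto (fun τ : ℂ => ∑' n : ℤ, (2 * Real.pi * Complex.I * (n + 1 / 2) *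
        Complex.exp (Real.pi * Complex.I * (n + 1 / 2))) *
          Complex.exp (Real.pi * Complex.I * (n ^ 2 + n : ℤ) * τ))
      (comap Complex.im atTop) (𝓝 (-(2 * Real.pi))) := by
  have h := tendsto_tsum_mul_exp (c := fun n : ℤ => 2 * Real.pi * Complex.I * (n + 1 / 2) *
      Complex.exp (Real.pi * Complex.I * (n + 1 / 2))) (e := fun n => n ^ 2 + n)
    (C := 2 * Real.pi) (fun n => ?_) sq_add_self_nonneg sq_sub_abs_le
  · rw [tsum_ite_sq_add_self] at h
    convert h using 2
    have e1 : (Real.pi * Complex.I * (((0 : ℤ) : ℂ) + 1 / 2) : ℂ) = Real.pi / 2 * Complex.I := by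
      push_cast; ring
    have e2 : (Real.pi * Complex.I * (((-1 : ℤ) : ℂ) + 1 / 2) : ℂ) =
        -(Real.pi / 2 * Complex.I) := by
      push_cast; ring
    rw [e1, e2, Complex.exp_neg, Complex.exp_pi_div_two_mul_I, Complex.inv_I]
    push_cast
    linear_combination (-2 * Real.pi : ℂ) * Complex.I_mul_I
  · have h1 : ‖Complex.exp (Real.pi * Complex.I * (n + 1 / 2))‖ = 1 := by
      rw [show (Real.pi * Complex.I * (n + 1 / 2) : ℂ) =
        ((Real.pi * (n + 1 / 2) : ℝ) : ℂ) * Complex.I by push_cast; ring]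
      exact Complex.norm_exp_ofReal_mul_I _
    rw [norm_mul, h1, mul_one, norm_mul, norm_mul, Complex.norm_I, mul_one]
    have h2 : ‖(2 * Real.pi : ℂ)‖ = 2 * Real.pi := by
      simp [abs_of_pos Real.pi_pos]
    rw [h2]
    refine mul_le_mul_of_nonneg_left ?_ (by positivity)
    refine (norm_add_le _ _).trans ?_
    rw [Complex.norm_intCast]
    norm_num

theorem tendsto_thetaChar_zero (ζ : ℝ) :
    Tendsto (fun τ : ℂ => thetaChar 0 0 ζ τ) (comap Complex.im atTop) (𝓝 1) := by
  have h := tendsto_tsum_mul_exp (c := fun n : ℤ => Complex.exp (2 * Real.pi * Complex.I * n * ζ))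
    (e := fun n => n ^ 2) (C := 1) (fun n => ?_) sq_nonneg (fun n => by simp)
  · convert h using 1
    · funext τ
      rw [thetaChar]
      refine tsum_congr fun n => ?_
      rw [← Complex.exp_add]
      congr 1
      push_cast
      ring
    · rw [tsum_eq_single 0 (fun n hn => by simp [hn])]
      simp
  · rw [show (2 * Real.pi * Complex.I * n * ζ : ℂ) =
        ((2 * Real.pi * n * ζ : ℝ) : ℂ) * Complex.I by push_cast; ring,
      Complex.norm_exp_ofReal_mul_I]
    linarith [abs_nonneg (n : ℝ)]

/-! ### Nonvanishing of theta constants by doubling -/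

/-- A property of points of the upper half plane that is stable under doubling holds along
`2 ^ k * τ`. -/
theorem forall_two_pow_mul {p : ℂ → Prop} (hp : ∀ τ : ℂ, 0 < τ.im → p τ → p (2 * τ)) {τ : ℂ}
    (hτ : 0 < τ.im) (h : p τ) (k : ℕ) : 0 < ((2 : ℂ) ^ k * τ).im ∧ p (2 ^ k * τ) := by
  induction k with
  | zero => simpa using ⟨hτ, h⟩
  | succ k ih =>
    have e : (2 : ℂ) ^ (k + 1) * τ = 2 * (2 ^ k * τ) := by ring
    rw [e]
    exact ⟨by simpa using ih.1, hp _ ih.1 ih.2⟩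

theorem thetaChar_zero_mul_half {τ : ℂ} (hτ : 0 < τ.im) :
    thetaChar 0 0 0 τ * thetaChar 0 0 (1 / 2) τ = thetaChar 0 0 (1 / 2) (2 * τ) ^ 2 := by
  have h := thetaChar_zero_mul_zero 0 (1 / 2) hτ
  rw [zero_add, zero_sub, thetaChar_zero_neg, thetaChar_one_half] at h
  rw [h]
  ring

theorem thetaChar_one_sq {τ : ℂ} (hτ : 0 < τ.im) :
    thetaChar 1 0 0 τ ^ 2 = 2 * thetaChar 1 0 0 (2 * τ) * thetaChar 0 0 0 (2 * τ) := by
  have h := thetaChar_one_mul_one 0 0 hτ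
  rw [zero_add, sub_zero] at h
  rw [sq, h]
  ring

/-- By `thetaChar_zero_mul_half` a zero at $\tau$ propagates to every $2^k\tau$, contradicting the
limit 1. -/
theorem thetaChar_zero_half_ne_zero {τ : ℂ} (hτ : 0 < τ.im) : thetaChar 0 0 (1 / 2) τ ≠ 0 := by
  intro h
  have hk := forall_two_pow_mul (p := fun σ => thetaChar 0 0 (1 / 2) σ = 0) (fun σ hσ h0 => by
    have := thetaChar_zero_mul_half hσ
    rw [h0, mul_zero] at this
    exact pow_eq_zero_iff two_ne_zero |>.mp this.symm) hτ h
  have ht := (tendsto_thetaChar_zero (1 / 2)).comp (tendsto_two_pow_mul hτ)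
  refine one_ne_zero (tendsto_nhds_unique ht (tendsto_const_nhds.congr fun k => ?_))
  have := (hk k).2
  simp only [Function.comp_apply]
  push_cast
  exact this.symm

theorem thetaChar_zero_zero_ne_zero {τ : ℂ} (hτ : 0 < τ.im) : thetaChar 0 0 0 τ ≠ 0 := by
  intro h
  have h2 := thetaChar_zero_mul_half hτ
  rw [h, zero_mul] at h2
  exact thetaChar_zero_half_ne_zero (τ := 2 * τ) (by simpa using hτ)
    (pow_eq_zero_iff two_ne_zero |>.mp h2.symm)

theorem thetaChar_one_zero_ne_zero {τ : ℂ} (hτ : 0 < τ.im) : thetaChar 1 0 0 τ ≠ 0 := by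
  intro h
  have hk := forall_two_pow_mul (p := fun σ => thetaChar 1 0 0 σ = 0) (fun σ hσ h0 => by
    have := thetaChar_one_sq hσ
    rw [h0, zero_pow two_ne_zero] at this
    have h2 := thetaChar_zero_zero_ne_zero (τ := 2 * σ) (by simpa using hσ)
    simpa [h2] using this.symm) hτ h
  have ht := tendsto_thetaChar_one_series.comp (tendsto_two_pow_mul hτ)
  refine two_ne_zero (α := ℂ) (tendsto_nhds_unique ht (tendsto_const_nhds.congr fun k => ?_))
  have := (hk k).2
  rw [thetaChar_one_zero_eq_tsum] at this
  exact ((mul_eq_zero.mp this).resolve_left (Complex.exp_ne_zero _)).symm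

/-! ### Jacobi's derivative formula -/

theorem hasDerivAt_thetaChar_one (z : ℂ) {τ : ℂ} (hτ : 0 < τ.im) :
    HasDerivAt (fun z => thetaChar 1 0 z τ) (deriv (fun z => thetaChar 1 0 z τ) z) z :=
  (differentiableAt_thetaChar 1 0 z hτ).hasDerivAt

theorem hasDerivAt_thetaChar_zero (z : ℂ) {τ : ℂ} (hτ : 0 < τ.im) :
    HasDerivAt (fun z => thetaChar 0 0 z τ) (deriv (fun z => thetaChar 0 0 z τ) z) z :=
  (differentiableAt_thetaChar 0 0 z hτ).hasDerivAt

theorem deriv_thetaChar_one_neg (z τ : ℂ) :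
    deriv (fun z => thetaChar 1 0 z τ) (-z) = -deriv (fun z => thetaChar 1 0 z τ) z := by
  have h := deriv_comp_neg (fun z => thetaChar 1 0 z τ) z
  simp only [thetaChar_one_neg] at h
  rw [h, neg_neg]

theorem deriv_thetaChar_zero_half (τ : ℂ) :
    deriv (fun z => thetaChar 0 0 z τ) (1 / 2) = 0 := by
  have h1 := deriv_comp_neg (fun z => thetaChar 0 0 z τ) (1 / 2)
  have h2 := deriv_comp_add_const (fun z => thetaChar 0 0 z τ) 1 (-(1 / 2))
  simp only [thetaChar_zero_neg, thetaChar_zero_add_one] at h1 h2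
  rw [show -(1 / 2 : ℂ) + 1 = 1 / 2 by norm_num] at h2
  rw [h2] at h1
  exact self_eq_neg.mp h1

/-- With arguments $z$ and $z+\frac12$ one term of the addition formula vanishes, since
$\theta[1;0](\frac12)=0$; differentiate the rest at $z=0$. -/
theorem thetaChar_one_mul_deriv_half {τ : ℂ} (hτ : 0 < τ.im) :
    thetaChar 1 0 0 τ * deriv (fun z => thetaChar 1 0 z τ) (1 / 2) =
      2 * deriv (fun z => thetaChar 1 0 z (2 * τ)) (1 / 2) * thetaChar 0 0 (1 / 2) (2 * τ) := by
  have h2 : 0 < (2 * τ).im := by simpa using hτ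
  have hfun : (fun z => thetaChar 1 0 z τ * thetaChar 1 0 (z + 1 / 2) τ) = fun z =>
      thetaChar 1 0 (2 * z + 1 / 2) (2 * τ) * thetaChar 0 0 (1 / 2) (2 * τ) := by
    funext z
    have h := thetaChar_one_mul_one z (z + 1 / 2) hτ
    rw [show z + (z + 1 / 2) = 2 * z + 1 / 2 by ring, show z - (z + 1 / 2) = -(1 / 2) by ring,
      thetaChar_zero_neg, thetaChar_one_neg, thetaChar_one_half, mul_zero, add_zero] at h
    exact h
  have hL := (hasDerivAt_thetaChar_one 0 hτ).mul
    (HasDerivAt.comp_add_const (0 : ℂ) (1 / 2) (hasDerivAt_thetaChar_one (0 + 1 / 2) hτ))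
  have hR := (HasDerivAt.comp (0 : ℂ) (hasDerivAt_thetaChar_one (2 * 0 + 1 / 2) h2)
    (((hasDerivAt_id' (0 : ℂ)).const_mul 2).add_const (1 / 2))).mul_const
      (thetaChar 0 0 (1 / 2) (2 * τ))
  have h0 := hL.unique (hfun ▸ hR)
  rw [mul_zero, zero_add, thetaChar_one_half, mul_zero, zero_add] at h0
  rw [h0]
  ring

/-- Jacobi's derivative formula. -/
theorem deriv_thetaChar_one_half {τ : ℂ} (hτ : 0 < τ.im) :
    deriv (fun z => thetaChar 1 0 z τ) (1 / 2) =
      -Real.pi * thetaChar 1 0 0 τ * thetaChar 0 0 0 τ * thetaChar 0 0 (1 / 2) τ := by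
  -- This ratio is invariant under doubling, so it equals its limit $-\pi$ along $2^k\tau$.
  set R : ℂ → ℂ := fun σ => deriv (fun z => thetaChar 1 0 z σ) (1 / 2) /
    (thetaChar 1 0 0 σ * (thetaChar 0 0 0 σ * thetaChar 0 0 (1 / 2) σ)) with hR
  have hdouble : ∀ σ : ℂ, 0 < σ.im → R (2 * σ) = R σ := by
    intro σ hσ
    have h2 : 0 < (2 * σ).im := by simpa using hσ
    have a1 := thetaChar_one_zero_ne_zero hσ
    have a2 := thetaChar_one_zero_ne_zero h2
    have a3 := thetaChar_zero_zero_ne_zero h2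
    have a4 := thetaChar_zero_half_ne_zero h2
    have b1 := thetaChar_one_mul_deriv_half hσ
    have b2 := thetaChar_one_sq hσ
    simp only [hR]
    rw [thetaChar_zero_mul_half hσ, div_eq_div_iff (mul_ne_zero a2 (mul_ne_zero a3 a4))
      (mul_ne_zero a1 (pow_ne_zero 2 a4))]
    refine mul_left_cancel₀ a1 ?_
    linear_combination thetaChar 0 0 (1 / 2) (2 * σ) ^ 2 *
      deriv (fun z => thetaChar 1 0 z (2 * σ)) (1 / 2) * b2 -
      thetaChar 1 0 0 (2 * σ) * thetaChar 0 0 0 (2 * σ) * thetaChar 0 0 (1 / 2) (2 * σ) * b1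
  have hk := forall_two_pow_mul (p := fun σ => R σ = R τ)
    (fun σ hσ h => (hdouble σ hσ).trans h) hτ rfl
  have hlim : Tendsto (fun k : ℕ => R (2 ^ k * τ)) atTop (𝓝 (-(2 * Real.pi) / (2 * (1 * 1)))) := by
    have h0 := tendsto_thetaChar_zero 0
    have h1 := tendsto_thetaChar_zero (1 / 2)
    push_cast at h0 h1
    have ht := ((tendsto_deriv_thetaChar_one_series.div (tendsto_thetaChar_one_series.mul
      (h0.mul h1)) (by norm_num)).comp (tendsto_two_pow_mul hτ))
    refine ht.congr fun k => ?_
    simp only [hR, Function.comp_apply, Pi.div_apply]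
    rw [deriv_thetaChar_one_half_eq_tsum (hk k).1, thetaChar_one_zero_eq_tsum,
      mul_assoc (Complex.exp _), mul_div_mul_left _ _ (Complex.exp_ne_zero _)]
  have hval := tendsto_nhds_unique hlim (tendsto_const_nhds.congr fun k => (hk k).2.symm)
  have a1 := thetaChar_one_zero_ne_zero hτ
  have a3 := thetaChar_zero_zero_ne_zero hτ
  have a4 := thetaChar_zero_half_ne_zero hτ
  simp only [hR] at hval
  rw [eq_div_iff (mul_ne_zero a1 (mul_ne_zero a3 a4))] at hval
  rw [← hval]
  ring

/-! ### Values and derivative at $1/4$ -/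

/-- The derivative of `t ↦ θ₂(z + t) θ₂(w - t)` at `0` through the addition formula. -/
theorem deriv_thetaChar_one_mul_sub (z w : ℂ) {τ : ℂ} (hτ : 0 < τ.im) :
    deriv (fun z => thetaChar 1 0 z τ) z * thetaChar 1 0 w τ -
        thetaChar 1 0 z τ * deriv (fun z => thetaChar 1 0 z τ) w =
      2 * (thetaChar 1 0 (z + w) (2 * τ) * deriv (fun z => thetaChar 0 0 z (2 * τ)) (z - w) +
        thetaChar 0 0 (z + w) (2 * τ) * deriv (fun z => thetaChar 1 0 z (2 * τ)) (z - w)) := by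
  have h2 : 0 < (2 * τ).im := by simpa using hτ
  have aff : ∀ {f : ℂ → ℂ} {f' : ℂ} (c k : ℂ), HasDerivAt f f' c →
      HasDerivAt (fun t => f (c + k * t)) (f' * k) 0 := by
    intro f f' c k hf
    have hin : HasDerivAt (fun t : ℂ => c + k * t) k 0 := by
      simpa using ((hasDerivAt_id' (0 : ℂ)).const_mul k).const_add c
    exact HasDerivAt.comp (0 : ℂ) (by simpa using hf) hin
  -- The sum of the arguments stays fixed, so only the difference factors get differentiated.
  have hfun : (fun t => thetaChar 1 0 (z + 1 * t) τ * thetaChar 1 0 (w + -1 * t) τ) = fun t =>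
      thetaChar 1 0 (z + w) (2 * τ) * thetaChar 0 0 (z - w + 2 * t) (2 * τ) +
        thetaChar 0 0 (z + w) (2 * τ) * thetaChar 1 0 (z - w + 2 * t) (2 * τ) := by
    funext t
    rw [thetaChar_one_mul_one _ _ hτ, show z + 1 * t + (w + -1 * t) = z + w by ring,
      show z + 1 * t - (w + -1 * t) = z - w + 2 * t by ring]
  have hL := (aff z 1 (hasDerivAt_thetaChar_one z hτ)).fun_mul
    (aff w (-1) (hasDerivAt_thetaChar_one w hτ))
  have hR := ((aff (z - w) 2 (hasDerivAt_thetaChar_zero (z - w) h2)).const_mul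
    (thetaChar 1 0 (z + w) (2 * τ))).fun_add
    ((aff (z - w) 2 (hasDerivAt_thetaChar_one (z - w) h2)).const_mul
      (thetaChar 0 0 (z + w) (2 * τ)))
  rw [hfun] at hL
  have h := hL.unique hR
  simp only [mul_zero, add_zero] at h
  linear_combination h

theorem thetaChar_one_quarter_sq {τ : ℂ} (hτ : 0 < τ.im) :
    thetaChar 1 0 (1 / 4) τ ^ 2 = thetaChar 0 0 (1 / 2) (2 * τ) * thetaChar 1 0 0 (2 * τ) := by
  have h := thetaChar_one_mul_one (1 / 4) (1 / 4) hτ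
  rw [sub_self, show (1 / 4 + 1 / 4 : ℂ) = 1 / 2 by norm_num, thetaChar_one_half] at h
  rw [sq, h]
  ring

theorem thetaChar_zero_quarter_sq {τ : ℂ} (hτ : 0 < τ.im) :
    thetaChar 0 0 (1 / 4) τ ^ 2 = thetaChar 0 0 (1 / 2) (2 * τ) * thetaChar 0 0 0 (2 * τ) := by
  have h := thetaChar_zero_mul_zero (1 / 4) (1 / 4) hτ
  rw [sub_self, show (1 / 4 + 1 / 4 : ℂ) = 1 / 2 by norm_num, thetaChar_one_half] at h
  rw [sq, h]
  ring

theorem thetaChar_zero_sq {τ : ℂ} (hτ : 0 < τ.im) :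
    thetaChar 0 0 0 τ ^ 2 = thetaChar 0 0 0 (2 * τ) ^ 2 + thetaChar 1 0 0 (2 * τ) ^ 2 := by
  have h := thetaChar_zero_mul_zero 0 0 hτ
  rw [add_zero, sub_zero] at h
  rw [sq, h]
  ring

/-- The logarithmic derivative of `θ₂` at `1 / 4`. -/
theorem deriv_thetaChar_one_quarter {τ : ℂ} (hτ : 0 < τ.im) :
    deriv (fun z => thetaChar 1 0 z τ) (1 / 4) =
      -Real.pi * thetaChar 0 0 0 (2 * τ) ^ 2 * thetaChar 1 0 (1 / 4) τ := by
  have h2 : 0 < (2 * τ).im := by simpa using hτ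
  have ha := thetaChar_one_quarter_sq hτ
  have ha0 : thetaChar 1 0 (1 / 4) τ ≠ 0 := by
    intro h
    rw [h, zero_pow two_ne_zero] at ha
    exact mul_ne_zero (thetaChar_zero_half_ne_zero h2) (thetaChar_one_zero_ne_zero h2) ha.symm
  -- By parity the left side is $2\theta\theta'$ at $1/4$; on the right the difference is $1/2$,
  -- where both derivatives are known.
  have h := deriv_thetaChar_one_mul_sub (1 / 4) (-(1 / 4)) hτ
  rw [deriv_thetaChar_one_neg, thetaChar_one_neg, add_neg_cancel, sub_neg_eq_add,
    show (1 / 4 + 1 / 4 : ℂ) = 1 / 2 by norm_num, deriv_thetaChar_zero_half,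
    deriv_thetaChar_one_half h2] at h
  refine mul_left_cancel₀ ha0 ?_
  linear_combination h / 2 + Real.pi * thetaChar 0 0 0 (2 * τ) ^ 2 * ha

/-! ### Values at $1/8$ and $3/8$, and the theorem -/

theorem thetaCharDeriv_one (ε' : ℝ) (τ : ℂ) :
    thetaCharDeriv 1 ε' τ = deriv (fun z => thetaChar 1 0 z τ) (ε' / 2) := by
  have h := deriv_comp_add_const (fun z => thetaChar 1 0 z τ) (ε' / 2) 0
  simp only [← thetaChar_eq_shift, zero_add] at h
  exact h

theorem mainTheorem4 (τ : ℂ) (hτ : 0 < τ.im) :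
    thetaChar 1 (1 / 4) 0 τ ^ 4 - thetaChar 1 (3 / 4) 0 τ ^ 4 ≠ 0 ∧
    thetaCharDeriv 1 (1 / 4) τ =
      (-2 * (Real.pi : ℂ) * thetaChar 1 (1 / 4) 0 τ * thetaChar 0 0 0 (4 * τ) ^ 2) /
        (thetaChar 1 (1 / 4) 0 τ ^ 4 - thetaChar 1 (3 / 4) 0 τ ^ 4) *
      (thetaChar 1 0 0 (4 * τ) * thetaChar 0 1 0 (4 * τ) *
          (thetaChar 0 0 0 (4 * τ) ^ 2 + 3 * thetaChar 1 0 0 (4 * τ) ^ 2) +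
        thetaChar 1 (3 / 4) 0 τ ^ 4) ∧
    thetaCharDeriv 1 (3 / 4) τ =
      (-2 * (Real.pi : ℂ) * thetaChar 1 (3 / 4) 0 τ * thetaChar 0 0 0 (4 * τ) ^ 2) /
        (thetaChar 1 (1 / 4) 0 τ ^ 4 - thetaChar 1 (3 / 4) 0 τ ^ 4) *
      (thetaChar 1 0 0 (4 * τ) * thetaChar 0 1 0 (4 * τ) *
          (thetaChar 0 0 0 (4 * τ) ^ 2 + 3 * thetaChar 1 0 0 (4 * τ) ^ 2) +
        thetaChar 1 (1 / 4) 0 τ ^ 4) := by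
  have hσ : 0 < (2 * τ).im := by simpa using hτ
  have hρ : 0 < (4 * τ).im := by simpa using hτ
  have e4 : 2 * (2 * τ) = 4 * τ := by ring
  have eC : thetaChar 0 1 0 (4 * τ) = thetaChar 0 0 (1 / 2) (4 * τ) := by
    rw [thetaChar_eq_shift]; norm_num
  have ex : thetaChar 1 (1 / 4) 0 τ = thetaChar 1 0 (1 / 8) τ := by
    rw [thetaChar_eq_shift]; norm_num
  have ey : thetaChar 1 (3 / 4) 0 τ = thetaChar 1 0 (3 / 8) τ := by
    rw [thetaChar_eq_shift]; norm_num
  have ex' : thetaCharDeriv 1 (1 / 4) τ = deriv (fun z => thetaChar 1 0 z τ) (1 / 8) := by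
    rw [thetaCharDeriv_one]; norm_num
  have ey' : thetaCharDeriv 1 (3 / 4) τ = deriv (fun z => thetaChar 1 0 z τ) (3 / 8) := by
    rw [thetaCharDeriv_one]; norm_num
  have ha := thetaChar_one_quarter_sq hσ
  have hb := thetaChar_zero_quarter_sq hσ
  have hu := thetaChar_one_sq hσ
  have hv := thetaChar_zero_sq hσ
  have hd := deriv_thetaChar_one_quarter hσ
  rw [e4] at ha hb hu hv hd
  have hA0 := thetaChar_one_zero_ne_zero hρ
  have hB0 := thetaChar_zero_zero_ne_zero hρ
  have hC0 := thetaChar_zero_half_ne_zero hρ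
  have hu0 := thetaChar_one_zero_ne_zero hσ
  have hv0 := thetaChar_zero_zero_ne_zero hσ
  have hw0 := thetaChar_zero_half_ne_zero hσ
  have hJ := deriv_thetaChar_one_half hσ
  have hxx := thetaChar_one_mul_one (1 / 8) (1 / 8) hτ
  have hyy := thetaChar_one_mul_one (3 / 8) (3 / 8) hτ
  have hxy := thetaChar_one_mul_one (3 / 8) (1 / 8) hτ
  have hsub := deriv_thetaChar_one_mul_sub (3 / 8) (1 / 8) hτ
  have hadd := deriv_thetaChar_one_mul_sub (3 / 8) (-(1 / 8)) hτ
  have h1 := thetaChar_one_add_one (-(1 / 4)) (2 * τ)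
  have h0 := thetaChar_zero_add_one (-(1 / 4)) (2 * τ)
  rw [thetaChar_one_neg, show -(1 / 4 : ℂ) + 1 = 3 / 4 by norm_num] at h1
  rw [thetaChar_zero_neg, show -(1 / 4 : ℂ) + 1 = 3 / 4 by norm_num] at h0
  rw [show (1 / 8 + 1 / 8 : ℂ) = 1 / 4 by norm_num, sub_self] at hxx
  rw [show (3 / 8 + 3 / 8 : ℂ) = 3 / 4 by norm_num, sub_self, h1, h0] at hyy
  rw [show (3 / 8 + 1 / 8 : ℂ) = 1 / 2 by norm_num,
    show (3 / 8 - 1 / 8 : ℂ) = 1 / 4 by norm_num, thetaChar_one_half] at hxy hsub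
  rw [deriv_thetaChar_one_neg, thetaChar_one_neg,
    show (3 / 8 + -(1 / 8) : ℂ) = 1 / 4 by norm_num,
    show (3 / 8 - -(1 / 8) : ℂ) = 1 / 2 by norm_num, deriv_thetaChar_zero_half, hJ] at hadd
  rw [hd] at hsub
  rw [ex, ey, ex', ey', eC]
  generalize deriv (fun z => thetaChar 1 0 z τ) (1 / 8) = x' at *
  generalize deriv (fun z => thetaChar 1 0 z τ) (3 / 8) = y' at *
  generalize thetaChar 1 0 (1 / 8) τ = x at *
  generalize thetaChar 1 0 (3 / 8) τ = y at *
  generalize thetaChar 1 0 (1 / 4) (2 * τ) = a at *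
  generalize thetaChar 0 0 (1 / 4) (2 * τ) = b at *
  generalize thetaChar 1 0 0 (2 * τ) = u at *
  generalize thetaChar 0 0 0 (2 * τ) = v at *
  generalize thetaChar 0 0 (1 / 2) (2 * τ) = w at *
  generalize thetaChar 1 0 0 (4 * τ) = A at *
  generalize thetaChar 0 0 0 (4 * τ) = B at *
  generalize thetaChar 0 0 (1 / 2) (4 * τ) = C at *
  have ha0 : a ≠ 0 := fun h => by simp [h, hA0, hC0] at ha
  have hb0 : b ≠ 0 := fun h => by simp [h, hB0, hC0] at hb
  have hx2 : x ^ 2 = b * u + a * v := by linear_combination hxx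
  have hy2 : y ^ 2 = b * u - a * v := by linear_combination hyy
  have hx4 : x ^ 4 = (b * u + a * v) ^ 2 := by rw [← hx2]; ring
  have hy4 : y ^ 4 = (b * u - a * v) ^ 2 := by rw [← hy2]; ring
  have hxy0 : x * y = w * a := by linear_combination hxy
  have hne : x * y ≠ 0 := hxy0 ▸ mul_ne_zero hw0 ha0
  have hD : x ^ 4 - y ^ 4 = 4 * (a * b * (u * v)) := by rw [hx4, hy4]; ring
  have hD0 : x ^ 4 - y ^ 4 ≠ 0 := by
    rw [hD]
    exact mul_ne_zero (by norm_num) (mul_ne_zero (mul_ne_zero ha0 hb0) (mul_ne_zero hu0 hv0))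
  have hx'y : x' * y = Real.pi * w * (B ^ 2 * a - u * v * b) := by
    linear_combination (hadd - hsub) / 2
  have hy'x : y' * x = -(Real.pi * w * (B ^ 2 * a + u * v * b)) := by
    linear_combination (hadd + hsub) / 2
  have hbu : b ^ 2 * u ^ 2 = 2 * A * B ^ 2 * C := by rw [hb, hu]; ring
  have hav : a ^ 2 * v ^ 2 = A * C * (A ^ 2 + B ^ 2) := by rw [ha, hv]; ring
  -- What remains of both formulas once the terms in $abuv$ cancel; the 3 in $K$ is what makes it
  -- hold.
  have hkey : 2 * (b ^ 2 * u ^ 2) * v ^ 2 =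
      B ^ 2 * (A * C * (B ^ 2 + 3 * A ^ 2) + b ^ 2 * u ^ 2 + a ^ 2 * v ^ 2) := by
    rw [hbu, hav, hv]; ring
  refine ⟨hD0, ?_, ?_⟩
  · rw [div_mul_eq_mul_div, eq_div_iff hD0]
    -- Only the product $x'y$ is known, so multiply by $y\ne0$.
    refine mul_right_cancel₀ (right_ne_zero_of_mul hne) ?_
    rw [hD, hy4]
    linear_combination (4 * (a * b * (u * v))) * hx'y +
      2 * Real.pi * B ^ 2 * (A * C * (B ^ 2 + 3 * A ^ 2) + (b * u - a * v) ^ 2) * hxy0 -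
      2 * Real.pi * w * a * hkey
  · rw [div_mul_eq_mul_div, eq_div_iff hD0]
    refine mul_right_cancel₀ (left_ne_zero_of_mul hne) ?_
    rw [hD, hx4]
    linear_combination (4 * (a * b * (u * v))) * hy'x +
      2 * Real.pi * B ^ 2 * (A * C * (B ^ 2 + 3 * A ^ 2) + (b * u + a * v) ^ 2) * hxy0 -
      2 * Real.pi * w * a * hkey
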